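/- A plane increasing tree on $[n]=\{1,\dots,n\}$ is a rooted tree whose vertices are labelled bijectively by the elements of $[n]$, such that every vertex has a larger label than its parent and the children of every vertex are linearly ordered. The rank of a vertex $v$ is the number of edges of a shortest path from $v$ to a leaf that is a descendant of $v$ (so leaves have rank $0$). For $k\ge 0$ and $n\ge 1$, let $X_k(n)$ be the number of vertices of rank $k$ in a uniformly random plane increasing tree on $[n]$, let $b_k(n)$ be the number of plane increasing trees on $[n]$ whose root has rank $k$, and let $B_k(x)=\sum_{n\ge 1} b_k(n)\,x^n/n!$. **Theorem.** For every fixed $k\ge 0$, the series $B_k(x)$ converges and is differentiable for $|x|<1/2$, the function $\xi\mapsto\sqrt{1-2\xi}\,B_k'(\xi)$ is integrable on $(0,1/2)$, and, as $n\to\infty$, $$\mathbb{E}[X_k(n)] = c_k\, n\,\bigl(1+O(n^{-1})\bigr),\qquad c_k := 2\int_0^{1/2}\sqrt{1-2\xi}\;B_k'(\xi)\,d\xi ,$$ where the constant implied by $O$ may depend on $k$. -/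

import Mathlib

/-- Rooted plane trees whose vertices carry natural number labels: a root together with the
ordered list of the subtrees hanging from its children (empty for a leaf). -/
inductive PlaneTree : Type
  | node (label : ℕ) (children : List PlaneTree) : PlaneTree

namespace PlaneTree

/-- The label of the root. -/
def rootLabel : PlaneTree → ℕ
  | node a _ => a

/-- The ordered list of the subtrees rooted at the children of the root. -/
def children : PlaneTree → List PlaneTree
  | node _ cs => cs

mutual

/-- The vertices of a tree in preorder, one entry for each vertex, each vertex being represented
by the subtree formed by it and its descendants. -/
def vertices : PlaneTree → List PlaneTree
  | node a cs => node a cs :: forestVertices cs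

/-- The vertices of an ordered forest, listed tree by tree. -/
def forestVertices : List PlaneTree → List PlaneTree
  | [] => []
  | c :: cs => vertices c ++ forestVertices cs

end

/-- The labels of all vertices, one entry for each vertex. -/
def labels (t : PlaneTree) : List ℕ :=
  t.vertices.map rootLabel

/-- Every vertex has a larger label than its parent. -/
def IsIncreasing (t : PlaneTree) : Prop :=
  ∀ v ∈ t.vertices, ∀ c ∈ v.children, v.rootLabel < c.rootLabel

/-- `t.HasLeafAt d`: some path with `d` edges descends from the root of `t` to a leaf. -/
inductive HasLeafAt : PlaneTree → ℕ → Prop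
  | leaf (a : ℕ) : HasLeafAt (node a []) 0
  | step (a : ℕ) (cs : List PlaneTree) (c : PlaneTree) (d : ℕ) (hc : c ∈ cs)
      (h : HasLeafAt c d) : HasLeafAt (node a cs) (d + 1)

/-- The rank of the root of `t`: the least number of edges of a path from the root to a leaf.
The rank of a vertex `v` of a tree is the rank of the root of the subtree of its descendants. -/
noncomputable def rank (t : PlaneTree) : ℕ :=
  sInf {d | t.HasLeafAt d}

/-- The number of vertices of rank `k` in `t`. -/
noncomputable def rankCount (k : ℕ) (t : PlaneTree) : ℕ :=
  t.vertices.countP (fun v => v.rank = k)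

/-- `t` is a plane increasing tree on `[n] = {1, …, n}`: its vertices are labelled bijectively
with the elements of `[n]`, and labels increase from parent to child. -/
def IsIncreasingOn (n : ℕ) (t : PlaneTree) : Prop :=
  t.labels.Nodup ∧ t.labels.toFinset = Finset.Icc 1 n ∧ t.IsIncreasing

theorem vertices_node (a : ℕ) (cs : List PlaneTree) :
    (node a cs).vertices = node a cs :: cs.flatMap vertices := by
  have h : ∀ l : List PlaneTree, forestVertices l = l.flatMap vertices := by
    intro l
    induction l with
    | nil => simp [forestVertices]
    | cons c l ih => simp [forestVertices, ih]
  rw [vertices, h]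

theorem finite_of_length_le (n m : ℕ) :
    {t : PlaneTree | t.vertices.length ≤ m ∧ ∀ x ∈ t.labels, x ≤ n}.Finite := by
  induction m with
  | zero =>
    refine Set.Finite.subset Set.finite_empty ?_
    rintro ⟨a, cs⟩ ⟨h, -⟩
    simp [vertices] at h
  | succ m ih =>
    set S := {t : PlaneTree | t.vertices.length ≤ m ∧ ∀ x ∈ t.labels, x ≤ n} with hS
    have : Finite S := ih
    have hL : {l : List S | l.length ≤ m}.Finite := List.finite_length_le S m
    refine (((Set.finite_Iic n).prod hL).image
      (fun p : ℕ × List S => node p.1 (p.2.map Subtype.val))).subset ?_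
    rintro ⟨a, cs⟩ ⟨h, hl⟩
    rw [vertices_node] at h
    simp only [labels, vertices_node] at hl
    have hmem : ∀ c ∈ cs, c ∈ S := by
      intro c hc
      refine ⟨?_, ?_⟩
      · have h1 : c.vertices.length ≤ (cs.flatMap vertices).length := by
          rw [List.length_flatMap]
          exact List.single_le_sum (by simp) _
            (List.mem_map_of_mem (f := fun c => (vertices c).length) hc)
        simp only [List.length_cons] at h
        omega
      · intro x hx
        simp only [labels, List.mem_map] at hx
        obtain ⟨v, hv, rfl⟩ := hx
        exact hl _ (List.mem_map_of_mem
          (List.mem_cons_of_mem _ (List.mem_flatMap.2 ⟨c, hc, hv⟩)))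
    have hlen : cs.length ≤ m := by
      have h1 : ∀ l : List PlaneTree, l.length ≤ (l.flatMap vertices).length := by
        intro l
        induction l with
        | nil => simp
        | cons c l ih =>
          obtain ⟨b, ds⟩ := c
          simp only [List.flatMap_cons, List.length_append, List.length_cons, vertices]
          omega
      have := h1 cs
      simp only [List.length_cons] at h
      omega
    refine ⟨(a, cs.pmap (fun c hc => (⟨c, hc⟩ : S)) hmem), ⟨?_, ?_⟩, ?_⟩
    · exact hl a (by simp [rootLabel])
    · simpa using hlen
    · simp [List.map_pmap]

theorem finite_isIncreasingOn (n : ℕ) : {t : PlaneTree | t.IsIncreasingOn n}.Finite := by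
  refine (finite_of_length_le n n).subset ?_
  rintro t ⟨hn, hs, -⟩
  refine ⟨?_, ?_⟩
  · have h := List.toFinset_card_of_nodup hn
    rw [hs] at h
    simp [labels] at h
    omega
  · intro x hx
    have : x ∈ t.labels.toFinset := List.mem_toFinset.2 hx
    rw [hs, Finset.mem_Icc] at this
    exact this.2

end PlaneTree

/-- The finite set of all plane increasing trees on `[n]`. -/
noncomputable def planeIncreasingTrees (n : ℕ) : Finset PlaneTree :=
  (PlaneTree.finite_isIncreasingOn n).toFinset

/-- The expected number of vertices of rank `k` in a uniformly random plane increasing tree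
on `[n]`. -/
noncomputable def expectedRankCount (k n : ℕ) : ℝ :=
  (∑ t ∈ planeIncreasingTrees n, (t.rankCount k : ℝ)) / ((planeIncreasingTrees n).card : ℝ)

/-- The number of plane increasing trees on `[n]` whose root has rank `k`
(there are none for `n = 0`). -/
noncomputable def rootRankNumber (k n : ℕ) : ℕ :=
  ((planeIncreasingTrees n).filter (fun t => t.rank = k)).card

/-- The exponential generating function of the trees whose root has rank `k`. -/
noncomputable def rootRankEGF (k : ℕ) (x : ℝ) : ℝ :=
  ∑' n : ℕ, (rootRankNumber k n : ℝ) / (n.factorial : ℝ) * x ^ n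

/-- The constant `c_k = 2 ∫_0^{1/2} √(1 - 2ξ) B_k'(ξ) dξ`. -/
noncomputable def rankConstant (k : ℕ) : ℝ :=
  2 * ∫ ξ in (0 : ℝ)..(1 / 2), Real.sqrt (1 - 2 * ξ) * deriv (rootRankEGF k) ξ

/-!
Every plane increasing tree on `[n + 1]` with `n ≥ 1` arises exactly once by attaching the leaf
`n + 1` to a tree on `[n]`, for which there are `2n - 1` places
(`PlaneTree.sum_planeIncreasingTrees_succ`). Hence the number of trees satisfies
`a_{n+1} = (2n - 1) a_n`.

For a statistic `f` of unlabelled trees, let `B_n(f)` be its sum over the trees on `[n]`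
(`rootTotal`) and `X_n(f)` its sum over the subtrees of descendants of all vertices of these trees
(`vertexTotal`). Attaching the leaf `n + 1` expresses `X_{n+1}(f)` and `B_{n+1}(f)` through totals
of size `n` of other statistics, and induction over `n`, for all `f` at once, gives
`X_{n+1}(f) = (2n + 1) X_n(f) + B_{n+1}(f) - 2n B_n(f)` (`vertexTotal_recurrence`). This is the
coefficient form of the differential equation `X' = X / (1 - 2x) + B'`, obtained without
decomposing trees at the root.

For the indicator of rank `k`, with `p_n` the probability that the root has rank `k`, the
recurrence is solved by `E_n = p_n + (2n - 1) ∑_{m < n} p_m / (4m² - 1)` (`expectedRankCount_eq`).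
As `0 ≤ p_m ≤ 1`, the tail of the series is at most `1 / (2 (2n - 1))`, so that
`E_n = 2 S n + O(1)` with `S = ∑ p_m / (4m² - 1)`. A path with `k` edges shows `S > 0`, so the
bounded error is a relative error `O(1 / n)`.

Finally, `B_k` has nonnegative coefficients, at most `2 ^ n`, so the integral of
`√(1 - 2ξ) B_k'(ξ)` may be taken term by term, and the value of
`∫ √(1 - 2ξ) ξ ^ n` (`card_mul_integral`) turns it into `S` (`integral_sqrt_mul_deriv`).
-/

namespace PlaneTree

/-- Structural induction over ordered forests: split off the root of the first tree. -/
theorem forest_induction {P : List PlaneTree → Prop} (nil : P [])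
    (cons : ∀ b ds cs, P ds → P cs → P (node b ds :: cs)) : ∀ F, P F
  | [] => nil
  | node b ds :: cs => cons b ds cs (forest_induction nil cons ds) (forest_induction nil cons cs)

/-- All forests obtained from an ordered forest by adding a leaf with label `a`, either as a new
tree at any position of the forest, or as a new child of a vertex at any position among the
children of that vertex. -/
def forestInsertLeaf (a : ℕ) : List PlaneTree → List (List PlaneTree)
  | [] => [[node a []]]
  | node b ds :: cs =>
      (node a [] :: node b ds :: cs) ::
        ((forestInsertLeaf a ds).map (fun ds' => node b ds' :: cs) ++
          (forestInsertLeaf a cs).map (fun cs' => node b ds :: cs'))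

/-- All trees obtained from a tree by attaching a leaf with label `a` to one of its vertices. -/
def insertLeaf (a : ℕ) : PlaneTree → List PlaneTree
  | node b cs => (forestInsertLeaf a cs).map (node b)

/-- The forest left after removing all vertices with label `a` and their descendants. -/
def forestDelete (a : ℕ) : List PlaneTree → List PlaneTree
  | [] => []
  | node b ds :: cs =>
      if b = a then forestDelete a cs else node b (forestDelete a ds) :: forestDelete a cs

/-- The labels of all vertices of an ordered forest. -/
def forestLabels (F : List PlaneTree) : List ℕ :=
  (forestVertices F).map rootLabel

/-- `ForestIncreasing b F`: labels increase from parent to child in the tree `node b F`. -/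
def ForestIncreasing : ℕ → List PlaneTree → Prop
  | _, [] => True
  | b, node c ds :: cs => b < c ∧ ForestIncreasing c ds ∧ ForestIncreasing b cs

/-- The ordered forest with every label replaced by `0`. -/
def forestShape : List PlaneTree → List PlaneTree
  | [] => []
  | node _ ds :: cs => node 0 (forestShape ds) :: forestShape cs

/-- The tree with every label replaced by `0`, standing for the underlying unlabelled tree. -/
def shape : PlaneTree → PlaneTree
  | node _ cs => node 0 (forestShape cs)

/-! ### Attaching and deleting the leaf with the greatest label -/

@[simp] theorem forestLabels_nil : forestLabels [] = [] := rfl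

@[simp] theorem forestLabels_cons (b : ℕ) (ds cs : List PlaneTree) :
    forestLabels (node b ds :: cs) = b :: (forestLabels ds ++ forestLabels cs) := by
  simp [forestLabels, forestVertices, vertices, rootLabel]

theorem labels_node (b : ℕ) (cs : List PlaneTree) :
    (node b cs).labels = b :: forestLabels cs := by
  simp [labels, forestLabels, vertices, rootLabel]

theorem forestLabels_insertLeaf (a : ℕ) (F : List PlaneTree) :
    ∀ F' ∈ forestInsertLeaf a F, (forestLabels F').Perm (a :: forestLabels F) := by
  induction F using forest_induction with
  | nil => simp [forestInsertLeaf]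
  | cons b ds cs ih1 ih2 =>
    intro F' hF'
    simp only [forestInsertLeaf, List.mem_cons, List.mem_append, List.mem_map] at hF'
    rcases hF' with rfl | ⟨ds', h, rfl⟩ | ⟨cs', h, rfl⟩
    · simp
    · simp only [forestLabels_cons]
      refine (((ih1 _ h).append_right _).cons b).trans ?_
      exact List.Perm.swap _ _ _
    · simp only [forestLabels_cons]
      refine (((ih2 _ h).append_left _).cons b).trans ?_
      refine (List.perm_middle.cons b).trans ?_
      exact List.Perm.swap _ _ _

theorem forestDelete_of_notMem (a : ℕ) (F : List PlaneTree) (h : a ∉ forestLabels F) :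
    forestDelete a F = F := by
  induction F using forest_induction with
  | nil => rw [forestDelete]
  | cons b ds cs ih1 ih2 =>
    simp only [forestLabels_cons, List.mem_cons, List.mem_append, not_or] at h
    simp [forestDelete, Ne.symm h.1, ih1 h.2.1, ih2 h.2.2]

theorem forestDelete_insertLeaf (a : ℕ) (F : List PlaneTree) (h : a ∉ forestLabels F) :
    ∀ F' ∈ forestInsertLeaf a F, forestDelete a F' = F := by
  induction F using forest_induction with
  | nil => simp [forestInsertLeaf, forestDelete]
  | cons b ds cs ih1 ih2 =>
    have h0 := h
    simp only [forestLabels_cons, List.mem_cons, List.mem_append, not_or] at h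
    have hb : b ≠ a := Ne.symm h.1
    intro F' hF'
    simp only [forestInsertLeaf, List.mem_cons, List.mem_append, List.mem_map] at hF'
    rcases hF' with rfl | ⟨ds', h', rfl⟩ | ⟨cs', h', rfl⟩
    · rw [forestDelete, if_pos rfl, forestDelete_of_notMem _ _ h0]
    · rw [forestDelete, if_neg hb, ih1 h.2.1 _ h', forestDelete_of_notMem _ _ h.2.2]
    · rw [forestDelete, if_neg hb, ih2 h.2.2 _ h', forestDelete_of_notMem _ _ h.2.1]

theorem nodup_forestInsertLeaf (a : ℕ) (F : List PlaneTree) (h : a ∉ forestLabels F) :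
    (forestInsertLeaf a F).Nodup := by
  induction F using forest_induction with
  | nil => simp [forestInsertLeaf]
  | cons b ds cs ih1 ih2 =>
    simp only [forestLabels_cons, List.mem_cons, List.mem_append, not_or] at h
    rw [forestInsertLeaf, List.nodup_cons, List.nodup_append]
    refine ⟨?_, (ih1 h.2.1).map ?_, (ih2 h.2.2).map ?_, ?_⟩
    · simp only [List.mem_append, List.mem_map, List.cons.injEq, node.injEq]
      rintro (⟨_, _, ⟨hb, _⟩, _⟩ | ⟨_, _, ⟨hb, _⟩, _⟩) <;> exact h.1 hb.symm
    · intro x y hxy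
      simpa using hxy
    · intro x y hxy
      simpa using hxy
    · rintro x hx y hy rfl
      obtain ⟨ds', -, rfl⟩ := List.mem_map.1 hx
      obtain ⟨cs', hcs, he⟩ := List.mem_map.1 hy
      obtain ⟨-, rfl⟩ := List.cons.inj he
      exact h.2.2 ((forestLabels_insertLeaf a _ _ hcs).mem_iff.2 (by simp))

theorem mem_forestInsertLeaf_cons_leaf (a : ℕ) (F : List PlaneTree) :
    node a [] :: F ∈ forestInsertLeaf a F := by
  rcases F with _ | ⟨⟨b, ds⟩, cs⟩ <;> simp [forestInsertLeaf]

theorem ForestIncreasing.lt_of_mem {b : ℕ} {F : List PlaneTree} (h : ForestIncreasing b F) :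
    ∀ x ∈ forestLabels F, b < x := by
  induction F using forest_induction generalizing b with
  | nil => simp
  | cons c ds cs ih1 ih2 =>
    rw [ForestIncreasing] at h
    obtain ⟨h1, h2, h3⟩ := h
    intro x hx
    simp only [forestLabels_cons, List.mem_cons, List.mem_append] at hx
    rcases hx with rfl | hx | hx
    · exact h1
    · exact h1.trans (ih1 h2 x hx)
    · exact ih2 h3 x hx

/-- A vertex carrying the greatest label is a leaf, so it can be put back after its deletion. -/
theorem mem_forestInsertLeaf_forestDelete {a b : ℕ} {F : List PlaneTree}
    (hF : ForestIncreasing b F) (hle : ∀ x ∈ forestLabels F, x ≤ a)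
    (hnd : (forestLabels F).Nodup) (ha : a ∈ forestLabels F) :
    F ∈ forestInsertLeaf a (forestDelete a F) := by
  induction F using forest_induction generalizing b with
  | nil => simp at ha
  | cons c ds cs ih1 ih2 =>
    rw [ForestIncreasing] at hF
    obtain ⟨h1, h2, h3⟩ := hF
    simp only [forestLabels_cons, List.mem_cons, List.mem_append, List.nodup_cons,
      List.nodup_append, not_or] at hle hnd ha
    obtain ⟨⟨hc1, hc2⟩, hn1, hn2, hdis⟩ := hnd
    by_cases hca : c = a
    · subst hca
      have hds : ds = [] := by
        rcases ds with _ | ⟨⟨e, es⟩, ds⟩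
        · rfl
        · exact absurd (h2.lt_of_mem e (by simp)) (not_lt.2 (hle e (by simp)))
      subst hds
      rw [forestDelete, if_pos rfl, forestDelete_of_notMem _ _ hc2]
      exact mem_forestInsertLeaf_cons_leaf c cs
    · rw [forestDelete, if_neg hca, forestInsertLeaf]
      rcases ha with ha | ha | ha
      · exact absurd ha.symm hca
      · have hcs : a ∉ forestLabels cs := fun h => hdis a ha a h rfl
        rw [forestDelete_of_notMem _ _ hcs]
        refine List.mem_cons_of_mem _ (List.mem_append_left _ (List.mem_map.2 ⟨ds, ?_, rfl⟩))
        exact ih1 h2 (fun x hx => hle x (by simp [hx])) hn1 ha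
      · have hds : a ∉ forestLabels ds := fun h => hdis a h a ha rfl
        rw [forestDelete_of_notMem _ _ hds]
        refine List.mem_cons_of_mem _ (List.mem_append_right _ (List.mem_map.2 ⟨cs, ?_, rfl⟩))
        exact ih2 h3 (fun x hx => hle x (by simp [hx])) hn2 ha

theorem forestIncreasing_insertLeaf {a b : ℕ} {F : List PlaneTree} (hb : b < a)
    (hlt : ∀ x ∈ forestLabels F, x < a) :
    ∀ F' ∈ forestInsertLeaf a F, (ForestIncreasing b F' ↔ ForestIncreasing b F) := by
  induction F using forest_induction generalizing b with
  | nil => simp [forestInsertLeaf, ForestIncreasing, hb]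
  | cons c ds cs ih1 ih2 =>
    simp only [forestLabels_cons, List.mem_cons, List.mem_append] at hlt
    intro F' hF'
    simp only [forestInsertLeaf, List.mem_cons, List.mem_append, List.mem_map] at hF'
    rcases hF' with rfl | ⟨ds', h, rfl⟩ | ⟨cs', h, rfl⟩
    · simp [ForestIncreasing, hb]
    · simp only [ForestIncreasing]
      rw [ih1 (hlt c (by simp)) (fun x hx => hlt x (by simp [hx])) ds' h]
    · simp only [ForestIncreasing]
      rw [ih2 hb (fun x hx => hlt x (by simp [hx])) cs' h]

theorem forestIncreasing_iff (b : ℕ) (F : List PlaneTree) :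
    ForestIncreasing b F ↔ (∀ c ∈ F, b < c.rootLabel) ∧
      ∀ v ∈ forestVertices F, ∀ c ∈ v.children, v.rootLabel < c.rootLabel := by
  induction F using forest_induction generalizing b with
  | nil => simp [ForestIncreasing, forestVertices]
  | cons c ds cs ih1 ih2 =>
    simp only [ForestIncreasing, ih1, ih2, forestVertices, vertices, List.cons_append,
      List.forall_mem_cons, List.forall_mem_append]
    simp only [show (node c ds).rootLabel = c from rfl, show (node c ds).children = ds from rfl]
    tauto

theorem isIncreasing_node (b : ℕ) (cs : List PlaneTree) :
    (node b cs).IsIncreasing ↔ ForestIncreasing b cs := by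
  simp [IsIncreasing, forestIncreasing_iff, vertices, rootLabel, children]

theorem isIncreasingOn_node (n b : ℕ) (cs : List PlaneTree) :
    (node b cs).IsIncreasingOn n ↔ (b :: forestLabels cs).Nodup ∧
      (b :: forestLabels cs).toFinset = Finset.Icc 1 n ∧ ForestIncreasing b cs := by
  rw [IsIncreasingOn, labels_node, isIncreasing_node]

theorem notMem_of_isIncreasingOn {n b : ℕ} {cs : List PlaneTree}
    (h : (node b cs).IsIncreasingOn n) : n + 1 ∉ forestLabels cs := by
  intro hm
  have : n + 1 ∈ (b :: forestLabels cs).toFinset := by simp [hm]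
  rw [((isIncreasingOn_node _ _ _).1 h).2.1] at this
  simp at this

/-- The trees on `[n + 1]` arise by attaching the leaf `n + 1` to the trees on `[n]`. -/
theorem isIncreasingOn_succ_iff {n : ℕ} (hn : 1 ≤ n) (t' : PlaneTree) :
    t'.IsIncreasingOn (n + 1) ↔ ∃ t : PlaneTree, t.IsIncreasingOn n ∧ t' ∈ t.insertLeaf (n + 1) := by
  -- Attaching the leaf `n + 1` below the root neither creates nor repairs a defect.
  have key : ∀ (b : ℕ) (F F' : List PlaneTree), b ≤ n → F' ∈ forestInsertLeaf (n + 1) F →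
      n + 1 ∉ forestLabels F →
      ((node b F').IsIncreasingOn (n + 1) ↔ (node b F).IsIncreasingOn n) := by
    intro b F F' hb hF' hnot
    have hp : (b :: forestLabels F').Perm ((n + 1) :: (b :: forestLabels F)) :=
      ((forestLabels_insertLeaf _ _ _ hF').cons b).trans (List.Perm.swap _ _ _)
    have hnb : n + 1 ∉ b :: forestLabels F := by
      simp only [List.mem_cons, not_or]
      exact ⟨by omega, hnot⟩
    have hI : Finset.Icc 1 (n + 1) = insert (n + 1) (Finset.Icc 1 n) := by
      ext x; simp only [Finset.mem_Icc, Finset.mem_insert]; omega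
    have hs : (b :: forestLabels F').toFinset = Finset.Icc 1 (n + 1) ↔
        (b :: forestLabels F).toFinset = Finset.Icc 1 n := by
      rw [List.toFinset_eq_of_perm _ _ hp, List.toFinset_cons, hI]
      constructor
      · intro h
        have h2 := congrArg (fun s => s.erase (n + 1)) h
        simpa [Finset.erase_insert_eq_erase, Finset.erase_eq_of_notMem, hnot,
          (by omega : n + 1 ≠ b), ← List.toFinset_cons, -List.toFinset_cons,
          Finset.erase_eq_of_notMem (mt List.mem_toFinset.1 hnb)] using h2
      · intro h
        rw [h]
    rw [isIncreasingOn_node, isIncreasingOn_node, hp.nodup_iff, List.nodup_cons, hs]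
    constructor
    · rintro ⟨⟨-, h1⟩, h2, h3⟩
      refine ⟨h1, h2, (forestIncreasing_insertLeaf (by omega) ?_ _ hF').1 h3⟩
      intro x hx
      have : x ∈ (b :: forestLabels F).toFinset := by simp [hx]
      rw [h2, Finset.mem_Icc] at this
      omega
    · rintro ⟨h1, h2, h3⟩
      refine ⟨⟨hnb, h1⟩, h2, (forestIncreasing_insertLeaf (by omega) ?_ _ hF').2 h3⟩
      intro x hx
      have : x ∈ (b :: forestLabels F).toFinset := by simp [hx]
      rw [h2, Finset.mem_Icc] at this
      omega
  constructor
  · obtain ⟨b, F'⟩ := t'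
    intro h
    obtain ⟨h1, h2, h3⟩ := (isIncreasingOn_node _ _ _).1 h
    have hmem : ∀ x, x ∈ b :: forestLabels F' ↔ 1 ≤ x ∧ x ≤ n + 1 := by
      intro x; rw [← List.mem_toFinset, h2, Finset.mem_Icc]
    -- The root has the least label, so it does not carry `n + 1 ≥ 2`.
    have hb : b ≤ n := by
      by_contra hb
      have hb' : b = n + 1 := by have := (hmem b).1 (by simp); omega
      have h1' : 1 ∈ b :: forestLabels F' := (hmem 1).2 (by omega)
      rcases List.mem_cons.1 h1' with h | h
      · omega
      · have := h3.lt_of_mem 1 h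
        omega
    have hmax : n + 1 ∈ forestLabels F' := by
      rcases List.mem_cons.1 ((hmem (n + 1)).2 (by omega)) with h | h
      · omega
      · exact h
    have hin := mem_forestInsertLeaf_forestDelete h3
      (fun x hx => ((hmem x).1 (by simp [hx])).2) h1.of_cons hmax
    have hnot : n + 1 ∉ forestLabels (forestDelete (n + 1) F') := by
      have := (forestLabels_insertLeaf _ _ _ hin).nodup_iff.1 h1.of_cons
      exact (List.nodup_cons.1 this).1
    exact ⟨node b (forestDelete (n + 1) F'), (key b _ _ hb hin hnot).1 h,
      List.mem_map.2 ⟨_, hin, rfl⟩⟩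
  · rintro ⟨⟨b, F⟩, h, ht'⟩
    obtain ⟨F', hF', rfl⟩ := List.mem_map.1 ht'
    refine (key b _ _ ?_ hF' (notMem_of_isIncreasingOn h)).2 h
    have : b ∈ (b :: forestLabels F).toFinset := by simp
    rw [((isIncreasingOn_node _ _ _).1 h).2.1, Finset.mem_Icc] at this
    exact this.2

theorem mem_planeIncreasingTrees {n : ℕ} {t : PlaneTree} :
    t ∈ planeIncreasingTrees n ↔ t.IsIncreasingOn n := by
  simp [planeIncreasingTrees]

/-- Summation over the trees on `[n + 1]` by attaching the leaf `n + 1`. Each tree is counted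
once: deleting the leaf recovers the tree on `[n]`, and different places give different trees. -/
theorem sum_planeIncreasingTrees_succ {n : ℕ} (hn : 1 ≤ n) (f : PlaneTree → ℝ) :
    ∑ t ∈ planeIncreasingTrees (n + 1), f t =
      ∑ t ∈ planeIncreasingTrees n, ((t.insertLeaf (n + 1)).map f).sum := by
  classical
  have hU : planeIncreasingTrees (n + 1) =
      (planeIncreasingTrees n).biUnion (fun t => (t.insertLeaf (n + 1)).toFinset) := by
    ext t
    simp [mem_planeIncreasingTrees, isIncreasingOn_succ_iff hn]
  rw [hU, Finset.sum_biUnion]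
  · refine Finset.sum_congr rfl fun t ht => ?_
    obtain ⟨b, F⟩ := t
    rw [List.sum_toFinset]
    refine (nodup_forestInsertLeaf _ _ ?_).map (fun x y h => by simpa using h)
    exact notMem_of_isIncreasingOn (mem_planeIncreasingTrees.1 ht)
  · rintro ⟨b, F⟩ hs ⟨c, G⟩ ht hne
    refine Finset.disjoint_left.2 fun u hu hu' => hne ?_
    obtain ⟨F', hF', rfl⟩ := List.mem_map.1 (List.mem_toFinset.1 hu)
    obtain ⟨G', hG', he⟩ := List.mem_map.1 (List.mem_toFinset.1 hu')
    obtain ⟨rfl, rfl⟩ := node.inj he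
    rw [← forestDelete_insertLeaf _ F
        (notMem_of_isIncreasingOn (mem_planeIncreasingTrees.1 hs)) _ hF',
      ← forestDelete_insertLeaf _ G
        (notMem_of_isIncreasingOn (mem_planeIncreasingTrees.1 ht)) _ hG']

end PlaneTree

namespace PlaneTree

/-! ### Sums over vertices when a leaf is attached -/

theorem length_forestInsertLeaf (a : ℕ) (F : List PlaneTree) :
    (forestInsertLeaf a F).length = 2 * (forestVertices F).length + 1 := by
  induction F using forest_induction with
  | nil => simp [forestInsertLeaf, forestVertices]
  | cons b ds cs ih1 ih2 =>
    simp only [forestInsertLeaf, forestVertices, vertices, List.length_cons, List.length_append,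
      List.length_map, ih1, ih2]
    omega

/-- The effect of attaching a leaf in all possible ways on a sum over the vertices of a forest:
a vertex `v` keeps its subtree unless the leaf is attached inside that subtree, in which case
the subtree runs through `v.insertLeaf a`. -/
theorem sum_forestInsertLeaf (a : ℕ) (f : PlaneTree → ℝ) (F : List PlaneTree) :
    ((forestInsertLeaf a F).map fun F' => ((forestVertices F').map f).sum).sum =
      ((forestVertices F).map fun v =>
          (2 * ((forestVertices F).length : ℝ) + 2 - 2 * (v.vertices.length : ℝ)) * f v +
            ((v.insertLeaf a).map f).sum).sum +
        (2 * ((forestVertices F).length : ℝ) + 1) * f (node a []) := by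
  -- The coefficients `2 |F| - 2 |v|` refer to the whole forest; `split` passes to those of a part.
  have split : ∀ (G : List PlaneTree) (x y : ℝ),
      ((forestVertices G).map fun v => (x + y - 2 * (v.vertices.length : ℝ)) * f v +
          ((v.insertLeaf a).map f).sum).sum =
        y * ((forestVertices G).map f).sum + ((forestVertices G).map fun v =>
          (x - 2 * (v.vertices.length : ℝ)) * f v + ((v.insertLeaf a).map f).sum).sum := by
    intro G x y
    rw [← List.sum_map_mul_left, ← List.sum_map_add]
    congr 1
    refine List.map_congr_left fun v _ => ?_
    ring
  induction F using forest_induction with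
  | nil => simp [forestInsertLeaf, forestVertices, vertices]
  | cons b ds cs ih1 ih2 =>
    set d := (forestVertices ds).length with hd
    set e := (forestVertices cs).length with he
    have hlen : ((forestVertices (node b ds :: cs)).length : ℝ) = 1 + d + e := by
      simp only [forestVertices, vertices, List.length_append, List.length_cons, ← hd, ← he]
      push_cast; ring
    have hT : ((node b ds).vertices.length : ℝ) = 1 + d := by
      simp only [vertices, List.length_cons, ← hd]
      push_cast; ring
    rw [hlen, forestInsertLeaf]
    simp only [List.map_cons, List.map_append, List.map_map, Function.comp_def, List.sum_cons,
      List.sum_append, forestVertices, vertices, List.cons_append, List.nil_append]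
    simp only [List.sum_map_add, List.map_const', List.sum_replicate, length_forestInsertLeaf,
      ih1, ih2, ← hd, ← he, nsmul_eq_mul]
    have e1 := split ds (2 * d + 2) (2 + 2 * e)
    have e2 := split cs (2 * e + 2) (2 + 2 * d)
    have c1 : (2 * d + 2 + (2 + 2 * e) : ℝ) = 2 * (1 + d + e) + 2 := by ring
    have c2 : (2 * e + 2 + (2 + 2 * d) : ℝ) = 2 * (1 + d + e) + 2 := by ring
    rw [c1] at e1
    rw [c2] at e2
    simp only [List.sum_map_add] at e1 e2
    have hI : ((node b ds).insertLeaf a).map f =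
        (forestInsertLeaf a ds).map fun ds' => f (node b ds') := by
      simp [insertLeaf, Function.comp_def]
    rw [hI]
    simp only [List.length_cons, ← hd]
    push_cast
    linear_combination -e1 - e2

theorem sum_insertLeaf (a : ℕ) (f : PlaneTree → ℝ) (t : PlaneTree) :
    ((t.insertLeaf a).map fun t' => (t'.vertices.map f).sum).sum =
      (t.vertices.map fun v =>
          (2 * (t.vertices.length : ℝ) - 2 * (v.vertices.length : ℝ)) * f v +
            ((v.insertLeaf a).map f).sum).sum +
        (2 * (t.vertices.length : ℝ) - 1) * f (node a []) := by
  obtain ⟨b, F⟩ := t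
  have h := sum_forestInsertLeaf a f F
  have c1 : (2 * ((node b F).vertices.length : ℝ)) = 2 * ((forestVertices F).length : ℝ) + 2 := by
    simp only [vertices, List.length_cons]; push_cast; ring
  rw [c1]
  simp only [insertLeaf, List.map_map, Function.comp_def, vertices, List.map_cons, List.sum_cons,
    List.length_cons, List.sum_map_add] at h ⊢
  rw [h]
  push_cast
  ring

theorem map_forestShape_forestInsertLeaf (a : ℕ) (F : List PlaneTree) :
    (forestInsertLeaf a F).map forestShape = forestInsertLeaf 0 (forestShape F) := by
  induction F using forest_induction with
  | nil => simp [forestInsertLeaf, forestShape]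
  | cons b ds cs ih1 ih2 =>
    simp only [forestInsertLeaf, forestShape, ← ih1, ← ih2, List.map_cons, List.map_append,
      List.map_map, Function.comp_def]

theorem map_shape_insertLeaf (a : ℕ) (t : PlaneTree) :
    (t.insertLeaf a).map shape = t.shape.insertLeaf 0 := by
  obtain ⟨b, F⟩ := t
  rw [insertLeaf, shape, insertLeaf, ← map_forestShape_forestInsertLeaf a, List.map_map,
    List.map_map]
  rfl

theorem length_forestVertices_forestShape (F : List PlaneTree) :
    (forestVertices (forestShape F)).length = (forestVertices F).length := by
  induction F using forest_induction with
  | nil => simp [forestShape]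
  | cons b ds cs ih1 ih2 => simp [forestShape, forestVertices, vertices, ih1, ih2]

theorem length_vertices_shape (t : PlaneTree) :
    t.shape.vertices.length = t.vertices.length := by
  obtain ⟨b, F⟩ := t
  simp [shape, vertices, length_forestVertices_forestShape]

theorem IsIncreasingOn.length_vertices {n : ℕ} {t : PlaneTree} (h : t.IsIncreasingOn n) :
    t.vertices.length = n := by
  have h1 := List.toFinset_card_of_nodup h.1
  rw [h.2.1] at h1
  simpa [labels] using h1.symm

end PlaneTree

open PlaneTree

/-- The sum of `f` over all unlabelled trees arising from `s` by attaching a leaf. -/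
noncomputable def leafExtensionSum (f : PlaneTree → ℝ) (s : PlaneTree) : ℝ :=
  ((s.insertLeaf 0).map f).sum

/-- The sum of a statistic `f` of unlabelled trees over the plane increasing trees on `[n]`. -/
noncomputable def rootTotal (f : PlaneTree → ℝ) (n : ℕ) : ℝ :=
  ∑ t ∈ planeIncreasingTrees n, f t.shape

/-- The sum of `f` over the subtrees of descendants of all vertices of all plane increasing trees
on `[n]`. -/
noncomputable def vertexTotal (f : PlaneTree → ℝ) (n : ℕ) : ℝ :=
  ∑ t ∈ planeIncreasingTrees n, (t.vertices.map fun v => f v.shape).sum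

/-! ### Recurrences for the totals over all trees -/

theorem sum_insertLeaf_shape (a : ℕ) (f : PlaneTree → ℝ) (t : PlaneTree) :
    ((t.insertLeaf a).map fun t' => f t'.shape).sum = leafExtensionSum f t.shape := by
  rw [leafExtensionSum, ← map_shape_insertLeaf a, List.map_map]
  rfl

theorem rootTotal_succ {n : ℕ} (hn : 1 ≤ n) (f : PlaneTree → ℝ) :
    rootTotal f (n + 1) = rootTotal (leafExtensionSum f) n := by
  rw [rootTotal, sum_planeIncreasingTrees_succ hn]
  exact Finset.sum_congr rfl fun t _ => sum_insertLeaf_shape _ _ _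

/-- Of the `2n - 1` places for the new leaf, `2n - 2|v|` lie outside the subtree of `v`; the
others turn this subtree into its extensions by a leaf, and every place also creates the subtree
consisting of the new leaf alone. -/
theorem vertexTotal_succ {n : ℕ} (hn : 1 ≤ n) (f : PlaneTree → ℝ) :
    vertexTotal f (n + 1) =
      vertexTotal (fun s => (2 * n - 2 * (s.vertices.length : ℝ)) * f s + leafExtensionSum f s) n +
        (2 * n - 1) * rootTotal (fun _ => f (node 0 [])) n := by
  rw [vertexTotal, sum_planeIncreasingTrees_succ hn, vertexTotal, rootTotal, Finset.mul_sum,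
    ← Finset.sum_add_distrib]
  refine Finset.sum_congr rfl fun t ht => ?_
  rw [sum_insertLeaf, (mem_planeIncreasingTrees.1 ht).length_vertices]
  simp only [sum_insertLeaf_shape, length_vertices_shape]
  rw [shape, forestShape]

theorem planeIncreasingTrees_one : planeIncreasingTrees 1 = {node 1 []} := by
  ext t
  rw [mem_planeIncreasingTrees, Finset.mem_singleton]
  constructor
  · intro h
    have hl := h.length_vertices
    obtain ⟨b, F⟩ := t
    rcases F with _ | ⟨⟨c, ds⟩, cs⟩
    · have := ((isIncreasingOn_node _ _ _).1 h).2.1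
      simp only [forestLabels_nil, List.toFinset_cons, List.toFinset_nil, insert_empty_eq,
        Finset.Icc_self, Finset.singleton_inj] at this
      rw [this]
    · simp [vertices, forestVertices] at hl
  · rintro rfl
    rw [isIncreasingOn_node]
    simp [ForestIncreasing]

theorem rootTotal_one (f : PlaneTree → ℝ) : rootTotal f 1 = f (node 0 []) := by
  simp [rootTotal, planeIncreasingTrees_one, shape, forestShape]

theorem vertexTotal_one (f : PlaneTree → ℝ) : vertexTotal f 1 = f (node 0 []) := by
  simp [vertexTotal, planeIncreasingTrees_one, shape, forestShape, vertices, forestVertices]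

theorem rootTotal_size_mul (f : PlaneTree → ℝ) (n : ℕ) (c : ℝ) :
    rootTotal (fun s => (c - 2 * (s.vertices.length : ℝ)) * f s + leafExtensionSum f s) n =
      (c - 2 * n) * rootTotal f n + rootTotal (leafExtensionSum f) n := by
  rw [rootTotal, rootTotal, rootTotal, Finset.mul_sum, ← Finset.sum_add_distrib]
  refine Finset.sum_congr rfl fun t ht => ?_
  rw [length_vertices_shape, (mem_planeIncreasingTrees.1 ht).length_vertices]

/-- The number of plane increasing trees satisfies `a_{n+1} = (2n - 1) a_n`. -/
theorem card_planeIncreasingTrees_succ {n : ℕ} (hn : 1 ≤ n) :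
    ((planeIncreasingTrees (n + 1)).card : ℝ) = (2 * n - 1) * (planeIncreasingTrees n).card := by
  have h := sum_planeIncreasingTrees_succ hn (fun _ => 1)
  simp only [Finset.sum_const, nsmul_eq_mul, mul_one] at h
  rw [h, mul_comm, ← nsmul_eq_mul, ← Finset.sum_const]
  refine Finset.sum_congr rfl fun t ht => ?_
  have hl := (mem_planeIncreasingTrees.1 ht).length_vertices
  obtain ⟨b, F⟩ := t
  simp only [vertices, List.length_cons] at hl
  simp only [List.map_const', List.sum_replicate, insertLeaf, List.length_map,
    length_forestInsertLeaf, nsmul_eq_mul, mul_one, ← hl]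
  push_cast
  ring

/-- The recurrence behind the differential equation `(1 - 2x) X' = X + (1 - 2x) B'` for the
generating functions of the two totals. The statistic has to vary in the induction: attaching
the leaf `n + 1` turns `f` into a combination of `f` and `leafExtensionSum f`. -/
theorem vertexTotal_recurrence {n : ℕ} (hn : 1 ≤ n) (f : PlaneTree → ℝ) :
    vertexTotal f (n + 1) =
      (2 * n + 1) * vertexTotal f n + rootTotal f (n + 1) - 2 * n * rootTotal f n := by
  induction n, hn using Nat.le_induction generalizing f with
  | base =>
    rw [vertexTotal_succ le_rfl, rootTotal_succ le_rfl]
    simp only [vertexTotal_one, rootTotal_one]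
    simp [vertices, forestVertices]
    ring
  | succ n hn ih =>
    have h1 := vertexTotal_succ (n := n + 1) (by omega) f
    have h2 := vertexTotal_succ hn f
    -- The weights for `n + 1` and for `n` differ by `2 f`, so only the statistic of step `n` matters.
    have h3 := ih (fun s => (2 * n - 2 * (s.vertices.length : ℝ)) * f s + leafExtensionSum f s)
    rw [rootTotal_size_mul, rootTotal_size_mul, ← rootTotal_succ (by omega),
      ← rootTotal_succ hn] at h3
    have h4 : vertexTotal (fun s => (2 * ((n + 1 : ℕ) : ℝ) - 2 * (s.vertices.length : ℝ)) * f s +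
          leafExtensionSum f s) (n + 1) = 2 * vertexTotal f (n + 1) +
        vertexTotal (fun s => (2 * n - 2 * (s.vertices.length : ℝ)) * f s +
          leafExtensionSum f s) (n + 1) := by
      simp only [vertexTotal, Finset.mul_sum, ← Finset.sum_add_distrib]
      refine Finset.sum_congr rfl fun t _ => ?_
      rw [← List.sum_map_mul_left, ← List.sum_map_add]
      congr 1
      refine List.map_congr_left fun v _ => ?_
      push_cast
      ring
    have h5 : rootTotal (fun _ => f (node 0 [])) (n + 1) =
        (2 * n - 1) * rootTotal (fun _ => f (node 0 [])) n := by
      simp only [rootTotal, Finset.sum_const, nsmul_eq_mul, card_planeIncreasingTrees_succ hn]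
      ring
    rw [h4, h5] at h1
    push_cast at h1 h3 ⊢
    linear_combination h1 + h3 - (2 * n + 1) * h2

namespace PlaneTree

/-! ### The rank as a statistic of unlabelled trees -/

theorem hasLeafAt_zero (b : ℕ) (F : List PlaneTree) : (node b F).HasLeafAt 0 ↔ F = [] := by
  constructor
  · intro h; cases h; rfl
  · rintro rfl; exact .leaf b

theorem hasLeafAt_succ (b d : ℕ) (F : List PlaneTree) :
    (node b F).HasLeafAt (d + 1) ↔ ∃ c ∈ F, c.HasLeafAt d := by
  constructor
  · intro h
    cases h with
    | step _ _ c _ hc h => exact ⟨c, hc, h⟩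
  · rintro ⟨c, hc, h⟩; exact .step b F c d hc h

theorem exists_mem_forestShape_hasLeafAt (F : List PlaneTree) :
    (forestShape F = [] ↔ F = []) ∧
      ∀ d, (∃ c ∈ forestShape F, c.HasLeafAt d) ↔ ∃ c ∈ F, c.HasLeafAt d := by
  induction F using forest_induction with
  | nil => simp [forestShape]
  | cons b ds cs ih1 ih2 =>
    refine ⟨by simp [forestShape], fun d => ?_⟩
    simp only [forestShape, List.exists_mem_cons_iff, ih2.2]
    cases d with
    | zero => rw [hasLeafAt_zero, hasLeafAt_zero, ih1.1]
    | succ d => rw [hasLeafAt_succ, hasLeafAt_succ, ih1.2]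

theorem rank_shape (t : PlaneTree) : t.shape.rank = t.rank := by
  obtain ⟨b, F⟩ := t
  have h := exists_mem_forestShape_hasLeafAt F
  rw [rank, rank, shape]
  congr 1
  ext d
  cases d with
  | zero => simp only [Set.mem_ofPred_eq, hasLeafAt_zero, h.1]
  | succ d => simp only [Set.mem_ofPred_eq, hasLeafAt_succ, h.2]

/-- The path with `d` edges whose labels `a, a + 1, …, a + d` increase away from the root. -/
def path : ℕ → ℕ → PlaneTree
  | a, 0 => node a []
  | a, d + 1 => node a [path (a + 1) d]

theorem hasLeafAt_path (a d e : ℕ) : (path a d).HasLeafAt e ↔ e = d := by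
  induction d generalizing a e with
  | zero => cases e <;> simp [path, hasLeafAt_zero, hasLeafAt_succ]
  | succ d ih => cases e <;> simp [path, hasLeafAt_zero, hasLeafAt_succ, ih]

theorem rank_path (a d : ℕ) : (path a d).rank = d := by
  simp [rank, hasLeafAt_path]

theorem labels_path (a d : ℕ) : (path a d).labels = List.range' a (d + 1) := by
  induction d generalizing a with
  | zero => simp [path, labels_node]
  | succ d ih =>
    rw [path, labels_node, List.range'_succ, ← ih]
    simp [forestLabels, forestVertices, labels]

theorem isIncreasing_path (a d : ℕ) : (path a d).IsIncreasing := by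
  induction d generalizing a with
  | zero => simp [path, isIncreasing_node, ForestIncreasing]
  | succ d ih =>
    rw [path, isIncreasing_node, forestIncreasing_iff]
    refine ⟨?_, ?_⟩
    · cases d <;> simp [path, rootLabel]
    · simpa [forestVertices, IsIncreasing] using ih (a + 1)

theorem path_mem_planeIncreasingTrees (d : ℕ) : path 1 d ∈ planeIncreasingTrees (d + 1) := by
  rw [mem_planeIncreasingTrees]
  refine ⟨?_, ?_, isIncreasing_path 1 d⟩
  · rw [labels_path]; exact List.nodup_range'
  · ext x
    rw [labels_path, List.mem_toFinset, List.mem_range'_1, Finset.mem_Icc]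
    omega

end PlaneTree

theorem rootRankNumber_pos (k : ℕ) : 0 < rootRankNumber k (k + 1) :=
  Finset.card_pos.2 ⟨path 1 k, Finset.mem_filter.2 ⟨path_mem_planeIncreasingTrees k, rank_path 1 k⟩⟩

theorem rootRankNumber_le (k n : ℕ) : rootRankNumber k n ≤ (planeIncreasingTrees n).card :=
  Finset.card_filter_le _ _

theorem planeIncreasingTrees_zero : planeIncreasingTrees 0 = ∅ := by
  refine Finset.eq_empty_of_forall_notMem fun t ht => ?_
  have := (mem_planeIncreasingTrees.1 ht).length_vertices
  obtain ⟨b, F⟩ := t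
  simp [vertices] at this

theorem rootRankNumber_zero (k : ℕ) : rootRankNumber k 0 = 0 := by
  simp [rootRankNumber, planeIncreasingTrees_zero]

theorem card_planeIncreasingTrees_pos {n : ℕ} (hn : 1 ≤ n) :
    0 < (planeIncreasingTrees n).card := by
  obtain ⟨d, rfl⟩ := Nat.exists_eq_add_of_le' hn
  exact Finset.card_pos.2 ⟨_, path_mem_planeIncreasingTrees d⟩

theorem rootTotal_rank (k n : ℕ) :
    rootTotal (fun s => if s.rank = k then 1 else 0) n = rootRankNumber k n := by
  simp only [rootTotal, rank_shape, rootRankNumber, Finset.card_filter]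
  push_cast
  rfl

theorem vertexTotal_rank (k n : ℕ) :
    vertexTotal (fun s => if s.rank = k then 1 else 0) n =
      ∑ t ∈ planeIncreasingTrees n, (t.rankCount k : ℝ) := by
  simp only [vertexTotal, rank_shape]
  refine Finset.sum_congr rfl fun t _ => ?_
  rw [rankCount]
  induction t.vertices with
  | nil => simp
  | cons v l ih =>
    rw [List.map_cons, List.sum_cons, ih, List.countP_cons]
    by_cases h : v.rank = k <;> simp [h, add_comm]

theorem sum_rankCount_one (k : ℕ) :
    ∑ t ∈ planeIncreasingTrees 1, (t.rankCount k : ℝ) = rootRankNumber k 1 := by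
  rw [← vertexTotal_rank, ← rootTotal_rank, vertexTotal_one, rootTotal_one]

theorem sum_rankCount_succ (k : ℕ) {n : ℕ} (hn : 1 ≤ n) :
    ∑ t ∈ planeIncreasingTrees (n + 1), (t.rankCount k : ℝ) =
      (2 * n + 1) * ∑ t ∈ planeIncreasingTrees n, (t.rankCount k : ℝ) +
        rootRankNumber k (n + 1) - 2 * n * rootRankNumber k n := by
  simp only [← vertexTotal_rank, ← rootTotal_rank]
  exact vertexTotal_recurrence hn _

/-! ### The integrals of `√(1 - 2ξ) ξ ^ n` -/

theorem integral_sqrt_mul_pow_zero :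
    ∫ ξ in (0 : ℝ)..(1 / 2), Real.sqrt (1 - 2 * ξ) * ξ ^ 0 = 1 / 3 := by
  have h := intervalIntegral.integral_eq_sub_of_hasDerivAt_of_le (a := 0) (b := 1 / 2)
    (f := fun ξ : ℝ => -(1 / 3) * Real.sqrt (1 - 2 * ξ) ^ 3)
    (f' := fun ξ : ℝ => Real.sqrt (1 - 2 * ξ) * ξ ^ 0) (by norm_num) (by fun_prop) ?_
    (Continuous.intervalIntegrable (by fun_prop) _ _)
  · rw [h]; norm_num
  · intro ξ hξ
    have hpos : 0 < 1 - 2 * ξ := by linarith [hξ.2]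
    have hs := Real.sqrt_pos.2 hpos
    have h1 : HasDerivAt (fun ξ : ℝ => 1 - 2 * ξ) (-2) ξ := by
      simpa using ((hasDerivAt_id ξ).const_mul 2).const_sub 1
    refine (((h1.sqrt hpos.ne').pow 3).const_mul (-(1 / 3))).congr_deriv ?_
    field_simp
    ring

/-- Integration by parts, from the derivative of `ξ ^ (n + 1) (1 - 2ξ) ^ (3 / 2)`. -/
theorem integral_sqrt_mul_pow_succ (n : ℕ) :
    (2 * n + 5) * ∫ ξ in (0 : ℝ)..(1 / 2), Real.sqrt (1 - 2 * ξ) * ξ ^ (n + 1) =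
      (n + 1) * ∫ ξ in (0 : ℝ)..(1 / 2), Real.sqrt (1 - 2 * ξ) * ξ ^ n := by
  have h := intervalIntegral.integral_eq_sub_of_hasDerivAt_of_le (a := 0) (b := 1 / 2)
    (f := fun ξ : ℝ => ξ ^ (n + 1) * Real.sqrt (1 - 2 * ξ) ^ 3)
    (f' := fun ξ : ℝ => (n + 1) * (Real.sqrt (1 - 2 * ξ) * ξ ^ n) -
      (2 * n + 5) * (Real.sqrt (1 - 2 * ξ) * ξ ^ (n + 1))) (by norm_num) (by fun_prop) ?_
    (Continuous.intervalIntegrable (by fun_prop) _ _)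
  · rw [intervalIntegral.integral_sub (Continuous.intervalIntegrable (by fun_prop) _ _)
      (Continuous.intervalIntegrable (by fun_prop) _ _), intervalIntegral.integral_const_mul,
      intervalIntegral.integral_const_mul] at h
    norm_num at h
    norm_num
    linarith
  · intro ξ hξ
    have hpos : 0 < 1 - 2 * ξ := by linarith [hξ.2]
    have hs := Real.sqrt_pos.2 hpos
    have hsq := Real.sq_sqrt hpos.le
    have h1 : HasDerivAt (fun ξ : ℝ => 1 - 2 * ξ) (-2) ξ := by
      simpa using ((hasDerivAt_id ξ).const_mul 2).const_sub 1
    refine ((hasDerivAt_pow (n + 1) ξ).mul ((h1.sqrt hpos.ne').pow 3)).congr_deriv ?_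
    simp only [Pi.pow_apply, Nat.add_sub_cancel]
    generalize Real.sqrt (1 - 2 * ξ) = s at *
    field_simp
    push_cast
    linear_combination s ^ 2 * (n + 1) * ξ ^ n * hsq

/-- The weights produced by the integral: `a_n / (n-1)! ∫ √(1-2ξ) ξ^(n-1) dξ = 1 / (4n² - 1)`. -/
theorem card_mul_integral (n : ℕ) :
    ((planeIncreasingTrees (n + 1)).card : ℝ) / (n.factorial : ℝ) *
      ∫ ξ in (0 : ℝ)..(1 / 2), Real.sqrt (1 - 2 * ξ) * ξ ^ n =
        1 / (4 * ((n + 1 : ℕ) : ℝ) ^ 2 - 1) := by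
  induction n with
  | zero =>
    rw [integral_sqrt_mul_pow_zero, planeIncreasingTrees_one]
    norm_num
  | succ n ih =>
    have h := integral_sqrt_mul_pow_succ n
    rw [card_planeIncreasingTrees_succ (by omega), Nat.factorial_succ]
    have hJ : ∫ ξ in (0 : ℝ)..(1 / 2), Real.sqrt (1 - 2 * ξ) * ξ ^ (n + 1) =
        (n + 1) / (2 * n + 5) * ∫ ξ in (0 : ℝ)..(1 / 2), Real.sqrt (1 - 2 * ξ) * ξ ^ n := by
      rw [div_mul_eq_mul_div, ← h]
      field_simp
    rw [hJ]
    have hf : (n.factorial : ℝ) ≠ 0 := by positivity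
    calc _ = (2 * n + 1) / (2 * n + 5) * (((planeIncreasingTrees (n + 1)).card : ℝ) /
          (n.factorial : ℝ) * ∫ ξ in (0 : ℝ)..(1 / 2), Real.sqrt (1 - 2 * ξ) * ξ ^ n) := by
          push_cast
          field_simp
          ring
      _ = _ := by
          rw [ih]
          push_cast
          have e1 : (4 * ((n : ℝ) + 1) ^ 2 - 1) = (2 * n + 1) * (2 * n + 3) := by ring
          have e2 : (4 * ((n : ℝ) + 1 + 1) ^ 2 - 1) = (2 * n + 3) * (2 * n + 5) := by ring
          rw [e1, e2]
          field_simp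

/-! ### Power series with coefficients bounded by `2 ^ n` -/

theorem card_planeIncreasingTrees_le (n : ℕ) :
    ((planeIncreasingTrees n).card : ℝ) ≤ 2 ^ n * n.factorial := by
  induction n with
  | zero => simp [planeIncreasingTrees_zero]
  | succ n ih =>
    rcases Nat.eq_zero_or_pos n with rfl | hn
    · simp [planeIncreasingTrees_one]
    · rw [card_planeIncreasingTrees_succ hn, Nat.factorial_succ, pow_succ]
      push_cast
      have hp : (0 : ℝ) ≤ 2 ^ n * n.factorial := by positivity
      have h1 : (1 : ℝ) ≤ n := by exact_mod_cast hn
      nlinarith [mul_le_mul_of_nonneg_left ih (by linarith : (0 : ℝ) ≤ 2 * n - 1)]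

/-- The coefficients of `B_k` are bounded by `2 ^ n`, so its radius of convergence is at
least `1 / 2`. -/
theorem rootRankNumber_div_factorial_le (k n : ℕ) :
    (rootRankNumber k n : ℝ) / (n.factorial : ℝ) ≤ 2 ^ n := by
  rw [div_le_iff₀ (by positivity)]
  exact (Nat.cast_le.2 (rootRankNumber_le k n)).trans (card_planeIncreasingTrees_le n)

theorem summable_mul_pow_of_abs_le {β : ℕ → ℝ} (hβ : ∀ n, |β n| ≤ 2 ^ n) {x : ℝ} (hx : |x| < 1 / 2) :
    Summable fun n => β n * x ^ n := by
  refine Summable.of_norm_bounded (g := fun n => (2 * |x|) ^ n)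
    (summable_geometric_of_lt_one (by positivity) (by linarith)) fun n => ?_
  rw [Real.norm_eq_abs, abs_mul, abs_pow, mul_pow]
  exact mul_le_mul_of_nonneg_right (hβ n) (by positivity)

theorem hasDerivAt_tsum_mul_pow_of_abs_le {β : ℕ → ℝ} (hβ : ∀ n, |β n| ≤ 2 ^ n) {x : ℝ} (hx : |x| < 1 / 2) :
    Summable (fun n => β n * (n * x ^ (n - 1))) ∧
    HasDerivAt (fun y => ∑' n, β n * y ^ n) (∑' n, β n * (n * x ^ (n - 1))) x := by
  set r : ℝ := (|x| + 1 / 2) / 2 with hr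
  have hx0 := abs_nonneg x
  have hr0 : 0 < r := by rw [hr]; linarith
  have hxr : |x| < r := by rw [hr]; linarith
  have hr1 : r < 1 / 2 := by rw [hr]; linarith
  have hr2 : ‖2 * r‖ < 1 := by
    rw [Real.norm_eq_abs, abs_of_pos (by linarith)]; linarith
  have h0 := summable_pow_mul_geometric_of_norm_lt_one 1 hr2
  have hu : Summable fun n : ℕ => ((n : ℝ) ^ 1 * (2 * r) ^ n) * r⁻¹ :=
    h0.mul_right _
  have hbd : ∀ n : ℕ, ∀ y ∈ Metric.ball (0 : ℝ) r,
      ‖β n * (n * y ^ (n - 1))‖ ≤ ((n : ℝ) ^ 1 * (2 * r) ^ n) * r⁻¹ := by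
    intro n y hy
    rw [mem_ball_zero_iff, Real.norm_eq_abs] at hy
    rcases n with _ | n
    · simp
    · rw [Real.norm_eq_abs, abs_mul, abs_mul, abs_pow, Nat.abs_cast, Nat.add_sub_cancel]
      calc _ ≤ 2 ^ (n + 1) * (((n + 1 : ℕ) : ℝ) * r ^ n) := by
            gcongr
            exact hβ _
        _ = _ := by
            rw [mul_pow, pow_succ r]
            field_simp
  have hxb : x ∈ Metric.ball (0 : ℝ) r := by simpa using hxr
  refine ⟨Summable.of_norm_bounded hu fun n => hbd n x hxb, ?_⟩
  refine hasDerivAt_tsum_of_isPreconnected hu Metric.isOpen_ball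
    (convex_ball (0 : ℝ) r).isPreconnected (fun n y _ => ?_) hbd hxb
    (summable_mul_pow_of_abs_le hβ hx) hxb
  exact (hasDerivAt_pow n y).const_mul (β n)

/-! ### The expected number of vertices of rank `k` -/

/-- The probability that the root of a random plane increasing tree on `[n]` has rank `k`. -/
noncomputable def rootRankProb (k n : ℕ) : ℝ :=
  (rootRankNumber k n : ℝ) / ((planeIncreasingTrees n).card : ℝ)

/-- The contribution of the subtrees of size `n` to the density of vertices of rank `k`. -/
noncomputable def rankWeight (k n : ℕ) : ℝ :=
  rootRankProb k n / (4 * (n : ℝ) ^ 2 - 1)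

theorem rootRankProb_nonneg (k n : ℕ) : 0 ≤ rootRankProb k n := by
  unfold rootRankProb; positivity

theorem rootRankProb_le_one (k n : ℕ) : rootRankProb k n ≤ 1 :=
  div_le_one_of_le₀ (Nat.cast_le.2 (rootRankNumber_le k n)) (by positivity)

theorem rankWeight_zero (k : ℕ) : rankWeight k 0 = 0 := by
  simp [rankWeight, rootRankProb, rootRankNumber_zero]

theorem four_mul_sq_sub_one_pos {n : ℕ} (hn : 1 ≤ n) : (0 : ℝ) < 4 * (n : ℝ) ^ 2 - 1 := by
  have h1 : (1 : ℝ) ≤ n := by exact_mod_cast hn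
  nlinarith

theorem rankWeight_nonneg (k n : ℕ) : 0 ≤ rankWeight k n := by
  rcases Nat.eq_zero_or_pos n with rfl | hn
  · rw [rankWeight_zero]
  · exact div_nonneg (rootRankProb_nonneg k n) (four_mul_sq_sub_one_pos hn).le

/-- The weight of size `k + 1` is positive, because a path with `k` edges has rank `k`. -/
theorem rankWeight_pos (k : ℕ) : 0 < rankWeight k (k + 1) := by
  refine div_pos (div_pos (Nat.cast_pos.2 (rootRankNumber_pos k)) (Nat.cast_pos.2 ?_)) ?_
  · exact card_planeIncreasingTrees_pos (by omega)
  · exact four_mul_sq_sub_one_pos (by omega)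

/-- The solution of the recurrence for the totals, after division by the number of trees. -/
theorem expectedRankCount_eq (k : ℕ) {n : ℕ} (hn : 1 ≤ n) :
    expectedRankCount k n =
      rootRankProb k n + (2 * n - 1) * ∑ m ∈ Finset.range n, rankWeight k m := by
  induction n, hn using Nat.le_induction with
  | base =>
    simp [expectedRankCount, sum_rankCount_one, rootRankProb, rankWeight_zero]
  | succ n hn ih =>
    have h1 : (1 : ℝ) ≤ n := by exact_mod_cast hn
    have h2 : (2 * n - 1 : ℝ) ≠ 0 := by linarith
    have h3 : (2 * n + 1 : ℝ) ≠ 0 := by linarith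
    have ha : ((planeIncreasingTrees n).card : ℝ) ≠ 0 :=
      Nat.cast_ne_zero.2 (card_planeIncreasingTrees_pos hn).ne'
    have hE : expectedRankCount k (n + 1) = rootRankProb k (n + 1) +
        ((2 * n + 1) * expectedRankCount k n - 2 * n * rootRankProb k n) / (2 * n - 1) := by
      simp only [expectedRankCount, rootRankProb]
      rw [sum_rankCount_succ k hn, card_planeIncreasingTrees_succ hn]
      field_simp
      ring
    rw [hE, ih, Finset.sum_range_succ, rankWeight,
      show (4 * (n : ℝ) ^ 2 - 1) = (2 * n - 1) * (2 * n + 1) by ring]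
    push_cast
    field_simp
    ring

/-- Telescoping of `1 / (4m² - 1) = (1 / (2m - 1) - 1 / (2m + 1)) / 2` bounds the tails of the
sum of the weights. -/
theorem sum_rankWeight_le (k : ℕ) {n N : ℕ} (hn : 1 ≤ n) (hN : n ≤ N) :
    ∑ m ∈ Finset.range N, rankWeight k m ≤
      ∑ m ∈ Finset.range n, rankWeight k m + (1 / (2 * n - 1) - 1 / (2 * N - 1)) / 2 := by
  induction N, hN using Nat.le_induction with
  | base => simp
  | succ N hN ih =>
    have h1 : (1 : ℝ) ≤ N := by exact_mod_cast hn.trans hN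
    have h2 : (2 * N - 1 : ℝ) ≠ 0 := by linarith
    have h3 : (2 * N + 1 : ℝ) ≠ 0 := by linarith
    have hw : rankWeight k N ≤ 1 / (4 * (N : ℝ) ^ 2 - 1) :=
      div_le_div_of_nonneg_right (rootRankProb_le_one k N)
        (four_mul_sq_sub_one_pos (hn.trans hN)).le
    have hN1 : (2 * ((N + 1 : ℕ) : ℝ) - 1) = 2 * N + 1 := by push_cast; ring
    have he : 1 / (4 * (N : ℝ) ^ 2 - 1) = (1 / (2 * N - 1) - 1 / (2 * N + 1)) / 2 := by
      rw [show (4 * (N : ℝ) ^ 2 - 1) = (2 * N - 1) * (2 * N + 1) by ring]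
      field_simp
      ring
    rw [Finset.sum_range_succ, hN1]
    rw [he] at hw
    linarith

theorem sum_range_rankWeight_le (k : ℕ) {n : ℕ} (hn : 1 ≤ n) (N : ℕ) :
    ∑ m ∈ Finset.range N, rankWeight k m ≤
      ∑ m ∈ Finset.range n, rankWeight k m + 1 / (2 * n - 1) / 2 := by
  have h1 : (1 : ℝ) ≤ n := by exact_mod_cast hn
  have hM : (1 : ℝ) ≤ (max n N : ℕ) := by exact_mod_cast hn.trans (le_max_left n N)
  have h := sum_rankWeight_le k hn (le_max_left n N)
  have hmono := Finset.sum_le_sum_of_subset_of_nonneg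
    (Finset.range_mono (le_max_right n N)) (fun m _ _ => rankWeight_nonneg k m)
  have hpos : 0 ≤ 1 / (2 * ((max n N : ℕ) : ℝ) - 1) := by
    apply div_nonneg zero_le_one; linarith
  linarith

theorem summable_rankWeight (k : ℕ) : Summable (rankWeight k) :=
  summable_of_sum_range_le (rankWeight_nonneg k) (sum_range_rankWeight_le k le_rfl)

theorem tsum_rankWeight_pos (k : ℕ) : 0 < ∑' n, rankWeight k n :=
  (summable_rankWeight k).tsum_pos (rankWeight_nonneg k) (k + 1) (rankWeight_pos k)

theorem abs_expectedRankCount_sub_le (k : ℕ) {n : ℕ} (hn : 1 ≤ n) :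
    |expectedRankCount k n - 2 * (∑' m, rankWeight k m) * n| ≤ 2 + ∑' m, rankWeight k m := by
  have h1 : (1 : ℝ) ≤ n := by exact_mod_cast hn
  have hS := tsum_rankWeight_pos k
  have hlow := (summable_rankWeight k).sum_le_tsum (Finset.range n)
    (fun m _ => rankWeight_nonneg k m)
  have hup := Real.tsum_le_of_sum_range_le (rankWeight_nonneg k) (sum_range_rankWeight_le k hn)
  have hp0 := rootRankProb_nonneg k n
  have hp1 := rootRankProb_le_one k n
  rw [expectedRankCount_eq k hn]
  set S := ∑' m, rankWeight k m
  set s := ∑ m ∈ Finset.range n, rankWeight k m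
  have hpos : (0 : ℝ) < 2 * n - 1 := by linarith
  have e1 : (2 * n - 1) * s ≤ (2 * n - 1) * S := mul_le_mul_of_nonneg_left hlow hpos.le
  have e2 : (2 * n - 1) * S ≤ (2 * n - 1) * s + 1 / 2 := by
    refine (mul_le_mul_of_nonneg_left hup hpos.le).trans_eq ?_
    field_simp
  rw [abs_le]
  constructor <;> linarith

/-! ### The integral defining the constant -/

theorem abs_rootRankNumber_div_factorial_le (k n : ℕ) :
    |(rootRankNumber k n : ℝ) / (n.factorial : ℝ)| ≤ 2 ^ n := by
  rw [abs_of_nonneg (by positivity)]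
  exact rootRankNumber_div_factorial_le k n

theorem integral_term (k n : ℕ) :
    ∫ ξ in (0 : ℝ)..(1 / 2), Real.sqrt (1 - 2 * ξ) *
      ((rootRankNumber k n : ℝ) / (n.factorial : ℝ) * (n * ξ ^ (n - 1))) = rankWeight k n := by
  rcases n with _ | n
  · simp [rankWeight_zero]
  · have ha : ((planeIncreasingTrees (n + 1)).card : ℝ) ≠ 0 :=
      Nat.cast_ne_zero.2 (card_planeIncreasingTrees_pos (by omega)).ne'
    have hc : ∀ ξ : ℝ, Real.sqrt (1 - 2 * ξ) * ((rootRankNumber k (n + 1) : ℝ) /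
        ((n + 1).factorial : ℝ) * (((n + 1 : ℕ) : ℝ) * ξ ^ (n + 1 - 1))) =
        (rootRankNumber k (n + 1) : ℝ) / (n.factorial : ℝ) *
          (Real.sqrt (1 - 2 * ξ) * ξ ^ n) := by
      intro ξ
      rw [Nat.factorial_succ, Nat.add_sub_cancel]
      push_cast
      field_simp
    simp only [hc]
    rw [intervalIntegral.integral_const_mul, rankWeight, div_eq_mul_one_div (rootRankProb _ _),
      ← card_mul_integral, rootRankProb]
    field_simp

/-- Termwise integration of `√(1 - 2ξ) B_k'(ξ)`, allowed because all terms are nonnegative. -/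
theorem integral_sqrt_mul_deriv (k : ℕ) :
    ∫ ξ in (0 : ℝ)..(1 / 2), Real.sqrt (1 - 2 * ξ) * deriv (rootRankEGF k) ξ =
      ∑' n, rankWeight k n := by
  have hle : (0 : ℝ) ≤ 1 / 2 := by norm_num
  set F : ℕ → ℝ → ℝ := fun n ξ => Real.sqrt (1 - 2 * ξ) *
    ((rootRankNumber k n : ℝ) / (n.factorial : ℝ) * (n * ξ ^ (n - 1))) with hF
  have hcont : ∀ n, Continuous (F n) := fun n => by simp only [hF]; fun_prop
  have hint : ∀ n, MeasureTheory.Integrable (F n)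
      (MeasureTheory.volume.restrict (Set.Ioo 0 (1 / 2))) := fun n =>
    (intervalIntegrable_iff_integrableOn_Ioo_of_le hle).1 ((hcont n).intervalIntegrable _ _)
  have hval : ∀ n, ∫ ξ in Set.Ioo (0 : ℝ) (1 / 2), F n ξ = rankWeight k n := by
    intro n
    rw [← integral_term, intervalIntegral.integral_of_le hle,
      MeasureTheory.integral_Ioc_eq_integral_Ioo]
  have hnorm : ∀ n, ∫ ξ in Set.Ioo (0 : ℝ) (1 / 2), ‖F n ξ‖ = rankWeight k n := by
    intro n
    rw [← hval]
    refine MeasureTheory.setIntegral_congr_fun measurableSet_Ioo fun ξ hξ => ?_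
    have := hξ.1.le
    exact Real.norm_of_nonneg (by simp only [hF]; positivity)
  have hsum := MeasureTheory.hasSum_integral_of_summable_integral_norm hint
    (by simpa only [hnorm] using summable_rankWeight k)
  simp only [hval] at hsum
  rw [hsum.tsum_eq, intervalIntegral.integral_of_le hle,
    MeasureTheory.integral_Ioc_eq_integral_Ioo]
  refine MeasureTheory.setIntegral_congr_fun measurableSet_Ioo fun ξ hξ => ?_
  have hξ' : |ξ| < 1 / 2 := by rw [abs_of_pos hξ.1]; exact hξ.2
  obtain ⟨-, hd⟩ := hasDerivAt_tsum_mul_pow_of_abs_le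
    (abs_rootRankNumber_div_factorial_le k) hξ'
  have hd' : deriv (rootRankEGF k) ξ = _ := hd.deriv
  simp only [hF, hd', tsum_mul_left]

theorem rankConstant_eq (k : ℕ) : rankConstant k = 2 * ∑' n, rankWeight k n := by
  rw [rankConstant, integral_sqrt_mul_deriv]

theorem theorem3p4 (k : ℕ) :
    (∀ x : ℝ, |x| < 1 / 2 →
      Summable (fun n : ℕ => (rootRankNumber k n : ℝ) / (n.factorial : ℝ) * x ^ n)) ∧
    (∀ x : ℝ, |x| < 1 / 2 → DifferentiableAt ℝ (rootRankEGF k) x) ∧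
    IntervalIntegrable (fun ξ : ℝ => Real.sqrt (1 - 2 * ξ) * deriv (rootRankEGF k) ξ)
      MeasureTheory.volume 0 (1 / 2) ∧
    ∃ ε : ℕ → ℝ,
      Asymptotics.IsBigO Filter.atTop ε (fun n : ℕ => ((n : ℝ))⁻¹) ∧
      ∀ n : ℕ, 1 ≤ n → expectedRankCount k n = rankConstant k * (n : ℝ) * (1 + ε n) := by
  have hβ := abs_rootRankNumber_div_factorial_le k
  have hS := tsum_rankWeight_pos k
  refine ⟨fun x hx => summable_mul_pow_of_abs_le hβ hx,
    fun x hx => (hasDerivAt_tsum_mul_pow_of_abs_le hβ hx).2.differentiableAt, ?_,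
    fun n => expectedRankCount k n / (rankConstant k * n) - 1, ?_, ?_⟩
  -- The integral has been evaluated to a positive number, whereas the integral of a
  -- non-integrable function is `0` by convention.
  · refine intervalIntegral.intervalIntegrable_of_integral_ne_zero ?_
    rw [integral_sqrt_mul_deriv]
    exact hS.ne'
  · rw [rankConstant_eq]
    refine Asymptotics.IsBigO.of_bound
      ((2 + ∑' m, rankWeight k m) / (2 * ∑' m, rankWeight k m)) ?_
    filter_upwards [Filter.eventually_ge_atTop 1] with n hn
    have hn0 : (0 : ℝ) < n := Nat.cast_pos.2 hn
    have hcn : 0 < 2 * (∑' m, rankWeight k m) * n := by positivity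
    rw [div_sub_one hcn.ne', norm_div, Real.norm_of_nonneg hcn.le, Real.norm_eq_abs, norm_inv,
      Real.norm_of_nonneg hn0.le, ← div_eq_mul_inv, div_div]
    exact div_le_div_of_nonneg_right (abs_expectedRankCount_sub_le k hn) hcn.le
  · intro n hn
    have hn0 : (n : ℝ) ≠ 0 := Nat.cast_ne_zero.2 (by omega)
    have hc : rankConstant k ≠ 0 := by rw [rankConstant_eq]; positivity
    field_simp
    ring
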